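/- All graphs are finite and simple; $P_n$ is the path on $n$ vertices and $C_n$ is the cycle on $n$ vertices. The lexicographic product $G\bullet H$ has vertex set $V(G)\times V(H)$, with $(u,v)$ adjacent to $(x,y)$ if and only if either $ux\in E(G)$, or $u=x$ and $vy\in E(H)$. In the game Cops and Cheating Robot on a graph $G$, the cops first choose their starting vertices (several cops may share a vertex), and then the robber chooses a starting vertex not occupied by a cop. After that the cops and the robber alternate turns, the cops moving first, with everyone's position visible to all. On the cops' turn each cop stays where she is or moves to an adjacent vertex; on the robber's turn he stays where he is or moves to an adjacent vertex. The robber is captured if he ends his turn on a vertex occupied by a cop, or if on his turn he traverses an edge that a cop traversed on the immediately preceding cops' turn. The cops win if they can force the robber to be captured after finitely many turns. The cheating robot number $c_{cr}(G)$ is the smallest number of cops that wins on $G$. Corollary. For all integers $n,m\ge 2$ and $r,s\ge 3$, $$c_{cr}(P_n\bullet P_m)=m+1,\qquad c_{cr}(P_n\bullet C_s)=s+2,\qquad c_{cr}(C_r\bullet P_m)=2m+1,\qquad c_{cr}(C_r\bullet C_s)=2s+2.$$ -/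

import Mathlib

namespace CheatingRobot

variable {V W : Type*}

/-- The lexicographic product `G • H` on `V × W`: the vertices `(u, v)` and `(x, y)` are adjacent
when `u` and `x` are adjacent in `G`, or `u = x` and `v`, `y` are adjacent in `H`. -/
def lexProd (G : SimpleGraph V) (H : SimpleGraph W) : SimpleGraph (V × W) where
  Adj p q := G.Adj p.1 q.1 ∨ (p.1 = q.1 ∧ H.Adj p.2 q.2)
  symm := ⟨by
    rintro p q (h | ⟨h, h'⟩)
    · exact Or.inl h.symm
    · exact Or.inr ⟨h.symm, h'.symm⟩⟩
  loopless := ⟨by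
    rintro p (h | ⟨_, h⟩)
    · exact G.loopless.irrefl _ h
    · exact H.loopless.irrefl _ h⟩

/-- A single move of a player: stay at a vertex or cross one edge. -/
def Step (G : SimpleGraph V) (u v : V) : Prop := u = v ∨ G.Adj u v

/-- The cops have just moved from the positions `c` to `c'`, and the robber answers by moving from
`r` to `r'`. He is caught if he ends his move on a vertex occupied by a cop, or if he traverses an
edge that a cop traversed in her previous move. -/
def Caught {k : ℕ} (c c' : Fin k → V) (r r' : V) : Prop :=
  (∃ i, c' i = r') ∨ (r ≠ r' ∧ ∃ i, s(c i, c' i) = s(r, r'))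

/-- `CopsWinFrom G c r`: with the cops at `c`, the robber at `r` and the cops to move, the cops can
force the robber to be caught after finitely many moves, whatever he does. -/
inductive CopsWinFrom (G : SimpleGraph V) {k : ℕ} : (Fin k → V) → V → Prop
  | move {c : Fin k → V} {r : V} (c' : Fin k → V) (hc : ∀ i, Step G (c i) (c' i))
      (h : ∀ r', Step G r r' → ¬ Caught c c' r r' → CopsWinFrom G c' r') : CopsWinFrom G c r

/-- `k` cops win Cops and Cheating Robot on `G`: they choose initial positions such that, wherever
the robber then starts on a vertex not occupied by a cop, they can force him to be caught. -/
def CopsWin (G : SimpleGraph V) (k : ℕ) : Prop :=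
  ∃ c : Fin k → V, ∀ r, (∀ i, c i ≠ r) → CopsWinFrom G c r

/-- The cheating robot number: the fewest cops that win on `G`. (On a finite graph some number of
cops wins, for instance one cop on each vertex.) -/
noncomputable def cheatingRobotNumber (G : SimpleGraph V) : ℕ := sInf {k | CopsWin G k}

end CheatingRobot

namespace CheatingRobot

variable {V W : Type*}

/-! The value is the minimum degree `δ(G)|W| + δ(H)` of the product. It is a lower bound because
each cop closes at most one of the robber's exits. It is attained by a sweep. A full layer of `|W|`
guards is a moving barrier, and every edge of `G` that jumps over a vertex ends in a permanently
guarded set: empty for a path, one vertex for a cycle. The other `δ(H)` cops play a winning strategy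
of `H` in the layer just past the barrier, so the robber is caught there or flees further on, and
the barrier advances. Paths and cycles are themselves won by `δ` cops with the same sweep. -/

/-- Each cop blocks at most one neighbour of the robber, so fewer cops than the minimum degree never
catch him. -/
theorem not_copsWinFrom_of_lt {G : SimpleGraph V} {k d : ℕ} (hkd : k < d)
    (hdeg : ∀ r, ∃ A : Finset V, d ≤ A.card ∧ ∀ a ∈ A, G.Adj r a) {c : Fin k → V} {r : V}
    (hr : ∀ i, c i ≠ r) : ¬ CopsWinFrom G c r := by
  classical
  intro h
  induction h with
  | @move c r c' hc h ih =>
    obtain ⟨A, hA, hadj⟩ := hdeg r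
    -- The exit closed by a cop: her own vertex, or, if she has just moved onto the robber, the
    -- vertex she came from.
    obtain ⟨a, haA, ha⟩ := Finset.exists_mem_notMem_of_card_lt_card
      (s := Finset.univ.image fun i => if c' i = r then c i else c' i) (t := A)
      ((Finset.card_image_le.trans_lt (by simpa using hkd)).trans_le hA)
    have hne := (hadj a haA).ne
    have hb : ∀ i, (if c' i = r then c i else c' i) ≠ a := by simpa using ha
    have hfree : ∀ i, c' i ≠ a := by
      intro i hi
      apply hb i
      rw [if_neg (by rw [hi]; exact hne.symm), hi]
    refine ih a (Or.inr (hadj a haA)) ?_ hfree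
    rintro (⟨i, hi⟩ | ⟨-, i, hi⟩)
    · exact hfree i hi
    · rcases Sym2.eq_iff.1 hi with ⟨h1, -⟩ | ⟨h1, h2⟩
      · exact hr i h1
      · exact hb i (by rw [if_pos h2, h1])

theorem le_of_copsWin [Nonempty V] {G : SimpleGraph V} {k d : ℕ}
    (hdeg : ∀ r, ∃ A : Finset V, d ≤ A.card ∧ ∀ a ∈ A, G.Adj r a) (h : CopsWin G k) : d ≤ k := by
  classical
  by_contra! hkd
  obtain ⟨c, hc⟩ := h
  obtain ⟨A, hA, -⟩ := hdeg (Classical.arbitrary V)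
  obtain ⟨r, -, hr⟩ := Finset.exists_mem_notMem_of_card_lt_card
    (s := Finset.univ.image c) (t := A)
    ((Finset.card_image_le.trans_lt (by simpa using hkd)).trans_le hA)
  have hr' : ∀ i, c i ≠ r := by simpa using hr
  exact not_copsWinFrom_of_lt hkd hdeg hr' (hc r hr')

theorem lexProd_exists_neighbors [Fintype W] {G : SimpleGraph V} {H : SimpleGraph W} {d e : ℕ}
    (hG : ∀ r, ∃ A : Finset V, d ≤ A.card ∧ ∀ a ∈ A, G.Adj r a)
    (hH : ∀ r, ∃ A : Finset W, e ≤ A.card ∧ ∀ a ∈ A, H.Adj r a) (r : V × W) :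
    ∃ A : Finset (V × W), d * Fintype.card W + e ≤ A.card ∧ ∀ a ∈ A, (lexProd G H).Adj r a := by
  classical
  obtain ⟨A, hA, hA'⟩ := hG r.1
  obtain ⟨B, hB, hB'⟩ := hH r.2
  refine ⟨A ×ˢ Finset.univ ∪ {r.1} ×ˢ B, ?_, ?_⟩
  · rw [Finset.card_union_of_disjoint]
    · rw [Finset.card_product, Finset.card_product, Finset.card_univ, Finset.card_singleton, one_mul]
      gcongr
    · rw [Finset.disjoint_left]
      rintro ⟨x, y⟩ h1 h2
      simp only [Finset.mem_product, Finset.mem_singleton] at h1 h2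
      exact (hA' x h1.1).ne h2.1.symm
  · rintro ⟨x, y⟩ h
    simp only [Finset.mem_union, Finset.mem_product, Finset.mem_singleton, Finset.mem_univ,
      and_true] at h
    rcases h with h | ⟨h1, h2⟩
    · exact Or.inl (hA' x h)
    · exact Or.inr ⟨h1.symm, hB' y h2⟩

theorem cheatingRobotNumber_eq [Nonempty V] {G : SimpleGraph V} {d : ℕ}
    (hdeg : ∀ r, ∃ A : Finset V, d ≤ A.card ∧ ∀ a ∈ A, G.Adj r a) (h : CopsWin G d) :
    cheatingRobotNumber G = d :=
  le_antisymm (Nat.sInf_le h) (le_csInf ⟨d, h⟩ fun _ hk => le_of_copsWin hdeg hk)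

/-! ### Sweeping a path-like graph -/

/-- Consecutive vertices are adjacent, and an edge that jumps over a vertex ends in the
set `t`. -/
structure IsSweepable {n : ℕ} (G : SimpleGraph (Fin n)) (t : Set (Fin n)) : Prop where
  adj_succ : ∀ a b : Fin n, a.val + 1 = b.val → G.Adj a b
  mem_of_jump : ∀ q a p : Fin n, q < a → a < p → G.Adj p q → q ∈ t

namespace IsSweepable

variable {n : ℕ} {G : SimpleGraph (Fin n)} {t : Set (Fin n)}

theorem lt_of_step (hG : IsSweepable G t) {a p q : Fin n} (hap : a < p) (hs : Step G p q)
    (hqa : q ≠ a) (hqt : q ∉ t) : a < q := by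
  by_contra hle
  have hlt : q < a := lt_of_le_of_ne (not_lt.1 hle) hqa
  rcases hs with rfl | hadj
  · exact hle hap
  · exact hqt (hG.mem_of_jump q a p hlt hap hadj)

/-- One cop sweeps the vertices in increasing order, while the others guard `t`. -/
theorem copsWinFrom {k : ℕ} {S : Type*} (e : Fin k ≃ Option S) {g : S → Fin n}
    (hG : IsSweepable G (Set.range g)) (a p : Fin n) (hap : a < p) :
    CopsWinFrom G (fun i => (e i).elim a g) p := by
  induction hd : n - a.val generalizing a p with
  | zero => omega
  | succ d ih =>
    have hp := p.isLt
    have hb : a.val + 1 < n := by have : a.val < p.val := hap; omega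
    let b : Fin n := ⟨a.val + 1, hb⟩
    refine .move (fun i => (e i).elim b g) ?_ ?_
    · intro i
      cases e i with
      | none => exact Or.inr (hG.adj_succ a b rfl)
      | some s => exact Or.inl rfl
    · intro q hs hq
      have hqb : q ≠ b := by
        rintro rfl
        exact hq (Or.inl ⟨e.symm none, by simp⟩)
      have hqg : q ∉ Set.range g := by
        rintro ⟨s, rfl⟩
        exact hq (Or.inl ⟨e.symm (some s), by simp⟩)
      -- The sweeper leaves `a` open, but from `b` the robber could enter it only along the edge she
      -- has just used.
      have hqa : q ≠ a ∨ b < p := by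
        by_contra! hcon
        obtain ⟨rfl, hpb⟩ := hcon
        have hpb' : p = b := by
          apply le_antisymm hpb
          rw [Fin.le_def]
          exact hap
        subst hpb'
        exact hq (Or.inr ⟨hap.ne', e.symm none, by simp [Sym2.eq_swap]⟩)
      refine ih b q ?_ (by simp only [b]; omega)
      by_cases hbp : b < p
      · exact hG.lt_of_step hbp hs hqb hqg
      · have := hG.lt_of_step hap hs (hqa.resolve_right hbp) hqg
        apply lt_of_le_of_ne _ hqb.symm
        rw [Fin.le_def]
        exact this

theorem copsWin {k : ℕ} {S : Type*} (e : Fin k ≃ Option S) {g : S → Fin n} (hn : 0 < n)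
    (hG : IsSweepable G (Set.range g)) : CopsWin G k := by
  refine ⟨fun i => (e i).elim ⟨0, hn⟩ g, fun r hr => hG.copsWinFrom e _ r ?_⟩
  have h0 := hr (e.symm none)
  simp only [Equiv.apply_symm_apply, Option.elim_none] at h0
  exact lt_of_le_of_ne (Fin.le_def.2 (Nat.zero_le _)) h0

end IsSweepable

/-! ### Sweeping the layers of a lexicographic product -/

theorem Step.fst {G : SimpleGraph V} {H : SimpleGraph W} {p q : V × W}
    (h : Step (lexProd G H) p q) : Step G p.1 q.1 := by
  rcases h with rfl | h | ⟨h, -⟩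
  · exact Or.inl rfl
  · exact Or.inr h
  · exact Or.inl h

theorem Step.snd {G : SimpleGraph V} {H : SimpleGraph W} {x : V} {v w : W}
    (h : Step (lexProd G H) (x, v) (x, w)) : Step H v w := by
  rcases h with h | h | ⟨-, h⟩
  · exact Or.inl (Prod.ext_iff.1 h).2
  · exact absurd h (G.loopless.irrefl _)
  · exact Or.inr h

theorem Step.layer (G : SimpleGraph V) {H : SimpleGraph W} {x : V} {v w : W}
    (h : Step H v w) : Step (lexProd G H) (x, v) (x, w) := by
  rcases h with rfl | h
  · exact Or.inl rfl
  · exact Or.inr (Or.inr ⟨rfl, h⟩)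

/-- Positions of the cops on a lexicographic product: one cop on each vertex of the layer `a`, the
chasers at `q`, and one cop on each vertex of the layers `g s`. -/
def layerPos {ι S : Type*} (g : S → V) (a : V) (q : ι → V × W) : W ⊕ ι ⊕ (S × W) → V × W
  | .inl w => (a, w)
  | .inr (.inl j) => q j
  | .inr (.inr s) => (g s.1, s.2)

namespace IsSweepable

variable {n k h : ℕ} {G : SimpleGraph (Fin n)} {H : SimpleGraph W} {S : Type*} {g : S → Fin n}

/-- The cops whose guards fill the layer `a` win. -/
def WinsAt (G : SimpleGraph (Fin n)) (H : SimpleGraph W) (e : Fin k ≃ W ⊕ Fin h ⊕ (S × W))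
    (g : S → Fin n) (a : Fin n) : Prop :=
  ∀ (q : Fin h → Fin n × W) (p : Fin n × W), (∀ j, (q j).1 = a) → a < p.1 →
    CopsWinFrom (lexProd G H) (layerPos g a q ∘ e) p

theorem lt_fst_of_not_caught (hG : IsSweepable G (Set.range g)) (e : Fin k ≃ W ⊕ Fin h ⊕ (S × W))
    {a : Fin n} {q : Fin h → Fin n × W} {c : Fin k → Fin n × W} {p p' : Fin n × W} (hap : a < p.1)
    (hs : Step (lexProd G H) p p') (hp' : ¬ Caught c (layerPos g a q ∘ e) p p') : a < p'.1 := by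
  refine hG.lt_of_step hap hs.fst ?_ ?_
  · rintro rfl
    exact hp' (Or.inl ⟨e.symm (.inl p'.2), by simp [layerPos]⟩)
  · rintro ⟨s, hs'⟩
    exact hp' (Or.inl ⟨e.symm (.inr (.inr (s, p'.2))), by simp [layerPos, hs']⟩)

/-- With the robber already past `b`, the whole front moves up to `b`. Layer `a` may be abandoned,
since every way back over `b` ends in a guarded layer. -/
theorem copsWinFrom_of_beyond (hG : IsSweepable G (Set.range g))
    (e : Fin k ≃ W ⊕ Fin h ⊕ (S × W)) {a b : Fin n} (hab : a.val + 1 = b.val)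
    (hb : WinsAt G H e g b) {q : Fin h → Fin n × W} {p : Fin n × W}
    (hq : ∀ j, (q j).1 = a ∨ (q j).1 = b) (hbp : b < p.1) :
    CopsWinFrom (lexProd G H) (layerPos g a q ∘ e) p := by
  have hadj := hG.adj_succ a b hab
  refine .move (layerPos g b (fun j => (b, (q j).2)) ∘ e) ?_ ?_
  · intro i
    simp only [Function.comp_apply]
    rcases e i with w | j | s
    · exact Or.inr (Or.inl hadj)
    · rcases hq j with hj | hj
      · exact Or.inr (Or.inl (by simpa only [layerPos, hj] using hadj))
      · exact Or.inl (Prod.ext hj rfl)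
    · exact Or.inl rfl
  · intro p' hs hp'
    exact hb _ p' (fun _ => rfl) (hG.lt_fst_of_not_caught e hbp hs hp')

/-- Induction on the game in `H`: while the robber stays in layer `b` his moves are legal there, and
he can leave only forwards. -/
theorem copsWinFrom_of_chase (hG : IsSweepable G (Set.range g))
    (e : Fin k ≃ W ⊕ Fin h ⊕ (S × W)) {a b : Fin n} (hab : a.val + 1 = b.val)
    (hb : WinsAt G H e g b) {c : Fin h → W} {v : W} (hcv : CopsWinFrom H c v) :
    CopsWinFrom (lexProd G H) (layerPos g a (fun j => (b, c j)) ∘ e) (b, v) := by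
  induction hcv with
  | @move c v c' hc _ ih =>
    refine .move (layerPos g a (fun j => (b, c' j)) ∘ e) ?_ ?_
    · intro i
      simp only [Function.comp_apply]
      rcases e i with w | j | s
      · exact Or.inl rfl
      · exact (hc j).layer G
      · exact Or.inl rfl
    · rintro ⟨x, v'⟩ hs hp'
      have hax : a < x := hG.lt_fst_of_not_caught e (by rw [Fin.lt_def]; simp only; omega) hs hp'
      have hbx : b ≤ x := by rw [Fin.le_def]; rw [Fin.lt_def] at hax; omega
      rcases hbx.eq_or_lt with rfl | hbx
      · refine ih v' hs.snd ?_
        rintro (⟨j, rfl⟩ | ⟨hne, j, hj⟩)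
        · exact hp' (Or.inl ⟨e.symm (.inr (.inl j)), by simp [layerPos]⟩)
        · refine hp' (Or.inr ⟨by simpa using hne, e.symm (.inr (.inl j)), ?_⟩)
          simpa [layerPos] using hj
      · exact hG.copsWinFrom_of_beyond e hab hb (fun _ => Or.inr rfl) hbx

theorem winsAt (hG : IsSweepable G (Set.range g)) (hH : CopsWin H h)
    (e : Fin k ≃ W ⊕ Fin h ⊕ (S × W)) (a : Fin n) : WinsAt G H e g a := by
  induction hd : n - a.val generalizing a with
  | zero => omega
  | succ d ih =>
    intro q p hq hap
    have hp := p.1.isLt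
    have hap' : a.val < p.1.val := hap
    obtain ⟨b, hab⟩ : ∃ b : Fin n, a.val + 1 = b.val := ⟨⟨a.val + 1, by omega⟩, rfl⟩
    have hb : WinsAt G H e g b := ih b (by omega)
    have hbp : b ≤ p.1 := by rw [Fin.le_def]; omega
    rcases hbp.eq_or_lt with hbp | hbp
    · obtain ⟨c, hc⟩ := hH
      refine .move (layerPos g a (fun j => (b, c j)) ∘ e) ?_ ?_
      · intro i
        simp only [Function.comp_apply]
        rcases e i with w | j | s
        · exact Or.inl rfl
        · exact Or.inr (Or.inl (by simpa only [layerPos, hq j] using hG.adj_succ a b hab))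
        · exact Or.inl rfl
      · rintro ⟨x, v⟩ hs hp'
        have hax : a < x := hG.lt_fst_of_not_caught e hap hs hp'
        have hbx : b ≤ x := by rw [Fin.le_def]; rw [Fin.lt_def] at hax; omega
        rcases hbx.eq_or_lt with rfl | hbx
        -- The robber's answer serves as his choice of starting vertex in the game on `H`.
        · refine hG.copsWinFrom_of_chase e hab hb (hc v ?_)
          rintro j rfl
          exact hp' (Or.inl ⟨e.symm (.inr (.inl j)), by simp [layerPos]⟩)
        · exact hG.copsWinFrom_of_beyond e hab hb (fun _ => Or.inr rfl) hbx
    · exact hG.copsWinFrom_of_beyond e hab hb (fun j => Or.inl (hq j)) hbp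

theorem copsWin_lexProd [Nonempty W] (hn : 0 < n) (hG : IsSweepable G (Set.range g))
    (hH : CopsWin H h) (e : Fin k ≃ W ⊕ Fin h ⊕ (S × W)) : CopsWin (lexProd G H) k := by
  let z : Fin n := ⟨0, hn⟩
  refine ⟨layerPos g z (fun _ => (z, Classical.arbitrary W)) ∘ e, fun r hr =>
    hG.winsAt hH e z _ r (fun _ => rfl) ?_⟩
  have h0 : z ≠ r.1 := by
    rintro h0
    exact hr (e.symm (.inl r.2)) (by simp [layerPos, h0])
  exact lt_of_le_of_ne (Fin.le_def.2 (Nat.zero_le _)) h0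

end IsSweepable

/-! ### Paths and cycles -/

theorem pathGraph_isSweepable (n : ℕ) :
    IsSweepable (SimpleGraph.pathGraph n) (Set.range (Empty.elim : Empty → Fin n)) where
  adj_succ a b h := SimpleGraph.pathGraph_adj.2 (Or.inl h)
  mem_of_jump q a p h1 h2 h := by
    rw [SimpleGraph.pathGraph_adj] at h
    rw [Fin.lt_def] at h1 h2
    omega

theorem cycleGraph_adj_iff {n : ℕ} (hn : 3 ≤ n) (u v : Fin n) :
    (SimpleGraph.cycleGraph n).Adj u v ↔ u.val + 1 = v.val ∨ v.val + 1 = u.val ∨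
      (u.val = 0 ∧ v.val + 1 = n) ∨ (v.val = 0 ∧ u.val + 1 = n) := by
  rw [SimpleGraph.cycleGraph_adj']
  rcases lt_trichotomy u v with h | rfl | h
  · rw [Fin.coe_sub_iff_lt.2 h, Fin.coe_sub_iff_le.2 h.le]
    rw [Fin.lt_def] at h
    omega
  · rw [Fin.coe_sub_iff_le.2 le_rfl]
    omega
  · rw [Fin.coe_sub_iff_lt.2 h, Fin.coe_sub_iff_le.2 h.le]
    rw [Fin.lt_def] at h
    omega

theorem cycleGraph_isSweepable {n : ℕ} (hn : 3 ≤ n) :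
    IsSweepable (SimpleGraph.cycleGraph n)
      (Set.range fun _ : Unit => (⟨0, by omega⟩ : Fin n)) where
  adj_succ a b h := (cycleGraph_adj_iff hn a b).2 (Or.inl h)
  mem_of_jump q a p h1 h2 h := by
    rw [cycleGraph_adj_iff hn] at h
    rw [Fin.lt_def] at h1 h2
    -- The only edge that jumps over a vertex joins `n - 1` to `0`.
    exact ⟨(), Fin.ext (by simp only; omega)⟩

theorem pathGraph_exists_neighbors {n : ℕ} (hn : 2 ≤ n) (r : Fin n) :
    ∃ A : Finset (Fin n), 1 ≤ A.card ∧ ∀ a ∈ A, (SimpleGraph.pathGraph n).Adj r a := by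
  have hr := r.isLt
  obtain ⟨b, hb⟩ : ∃ b : Fin n, (SimpleGraph.pathGraph n).Adj r b := by
    by_cases h : r.val = 0
    · exact ⟨⟨1, by omega⟩, SimpleGraph.pathGraph_adj.2 (Or.inl (by simp only; omega))⟩
    · exact ⟨⟨r.val - 1, by omega⟩, SimpleGraph.pathGraph_adj.2 (Or.inr (by simp only; omega))⟩
  exact ⟨{b}, by simp, by simpa using hb⟩

theorem cycleGraph_exists_neighbors {n : ℕ} (hn : 3 ≤ n) (r : Fin n) :
    ∃ A : Finset (Fin n), 2 ≤ A.card ∧ ∀ a ∈ A, (SimpleGraph.cycleGraph n).Adj r a := by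
  obtain ⟨n, rfl⟩ := Nat.exists_eq_add_of_le' hn
  refine ⟨(SimpleGraph.cycleGraph (n + 3)).neighborFinset r, ?_, fun a ha => by simpa using ha⟩
  rw [SimpleGraph.card_neighborFinset_eq_degree, SimpleGraph.cycleGraph_degree_three_le]

theorem pathGraph_copsWin {n : ℕ} (hn : 0 < n) : CopsWin (SimpleGraph.pathGraph n) 1 :=
  (pathGraph_isSweepable n).copsWin (Fintype.equivOfCardEq (by simp)) hn

theorem cycleGraph_copsWin {n : ℕ} (hn : 3 ≤ n) : CopsWin (SimpleGraph.cycleGraph n) 2 :=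
  (cycleGraph_isSweepable hn).copsWin (Fintype.equivOfCardEq (by simp)) (by omega)

theorem cheatingRobotNumber_path_lexProd {n m e : ℕ} (hn : 2 ≤ n) (hm : 0 < m)
    {H : SimpleGraph (Fin m)} (hdeg : ∀ r, ∃ A : Finset (Fin m), e ≤ A.card ∧ ∀ a ∈ A, H.Adj r a)
    (hH : CopsWin H e) :
    cheatingRobotNumber (lexProd (SimpleGraph.pathGraph n) H) = m + e := by
  have : Nonempty (Fin m) := ⟨⟨0, hm⟩⟩
  have : Nonempty (Fin n) := ⟨⟨0, by omega⟩⟩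
  refine cheatingRobotNumber_eq ?_ ?_
  · simpa using lexProd_exists_neighbors (pathGraph_exists_neighbors hn) hdeg
  · exact (pathGraph_isSweepable n).copsWin_lexProd (by omega) hH
      (Fintype.equivOfCardEq (by simp))

theorem cheatingRobotNumber_cycle_lexProd {n m e : ℕ} (hn : 3 ≤ n) (hm : 0 < m)
    {H : SimpleGraph (Fin m)} (hdeg : ∀ r, ∃ A : Finset (Fin m), e ≤ A.card ∧ ∀ a ∈ A, H.Adj r a)
    (hH : CopsWin H e) :
    cheatingRobotNumber (lexProd (SimpleGraph.cycleGraph n) H) = 2 * m + e := by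
  have : Nonempty (Fin m) := ⟨⟨0, hm⟩⟩
  have : Nonempty (Fin n) := ⟨⟨0, by omega⟩⟩
  refine cheatingRobotNumber_eq ?_ ?_
  · simpa using lexProd_exists_neighbors (cycleGraph_exists_neighbors hn) hdeg
  · exact (cycleGraph_isSweepable hn).copsWin_lexProd (by omega) hH
      (Fintype.equivOfCardEq (by simp; omega))

end CheatingRobot

theorem mainTheorem11 (n m r s : ℕ) (hn : 2 ≤ n) (hm : 2 ≤ m) (hr : 3 ≤ r) (hs : 3 ≤ s) :
    CheatingRobot.cheatingRobotNumber
        (CheatingRobot.lexProd (SimpleGraph.pathGraph n) (SimpleGraph.pathGraph m)) = m + 1 ∧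
    CheatingRobot.cheatingRobotNumber
        (CheatingRobot.lexProd (SimpleGraph.pathGraph n) (SimpleGraph.cycleGraph s)) = s + 2 ∧
    CheatingRobot.cheatingRobotNumber
        (CheatingRobot.lexProd (SimpleGraph.cycleGraph r) (SimpleGraph.pathGraph m)) = 2 * m + 1 ∧
    CheatingRobot.cheatingRobotNumber
        (CheatingRobot.lexProd (SimpleGraph.cycleGraph r) (SimpleGraph.cycleGraph s)) =
      2 * s + 2 := by
  have hm0 : 0 < m := by omega
  have hs0 : 0 < s := by omega
  have hP := CheatingRobot.pathGraph_exists_neighbors hm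
  have hC := CheatingRobot.cycleGraph_exists_neighbors hs
  have hP' := CheatingRobot.pathGraph_copsWin hm0
  have hC' := CheatingRobot.cycleGraph_copsWin hs
  exact ⟨CheatingRobot.cheatingRobotNumber_path_lexProd hn hm0 hP hP',
    CheatingRobot.cheatingRobotNumber_path_lexProd hn hs0 hC hC',
    CheatingRobot.cheatingRobotNumber_cycle_lexProd hr hm0 hP hP',
    CheatingRobot.cheatingRobotNumber_cycle_lexProd hr hs0 hC hC'⟩
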